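/- Fix a scalar field $\mathbb{K}\in\{\mathbb{R},\mathbb{C}\}$; all spaces are Banach spaces over $\mathbb{K}$. A space $Y$ is finitely representable in $Z$ if for every $\varepsilon>0$ and every finite-dimensional subspace $A\subseteq Y$ there are a subspace $B\subseteq Z$ and an isomorphism $u:A\to B$ with $\|u\|\,\|u^{-1}\|\le 1+\varepsilon$. For a Banach space $X$ let $X^f$ be the class of all Banach spaces $Z$ such that $X$ is finitely representable in $Z$ and $Z$ is finitely representable in $X$. A norm-one projection of a space $F$ onto a subspace $S$ is a linear map $P:F\to F$ with values in $S$, $P|_S=\mathrm{id}_S$ and $\|P\|\le 1$ (so $\|P\|=1$ unless $S=0$). A Banach space $E$ is called - universally complemented in $X^f$, if for every $Z\in X^f$ and every isometric linear embedding $i:E\to Z$ there is a norm-one projection of $Z$ onto $i(E)$; - algebraically closed in $X^f$, if for every $Z\in X^f$ and every isometric linear embedding $i:E\to Z$ there is a norm-one projection of $Z^{**}$ onto $i^{**}(E^{**})$; - quasi-dual, if there is a norm-one projection of $E^{**}$ onto the canonical image of $E$ in $E^{**}$. Let $X$ and $E$ be Banach spaces. 1. If $E$ is finitely representable in $X$,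 then $E$ is universally complemented in $X^f$ if and only if $E$ is algebraically closed in $X^f$ and quasi-dual. (That is, $\mathfrak{P}_1(X^f)=\mathcal{A}(X^f)\cap\mathfrak{qd}$, where these classes are taken among the spaces finitely representable in $X$.) 2. $E$ is universally complemented in $X^f$ if and only if for every $Z\in X^f$, every isometric linear embedding $i:E\to Z$, every Banach space $W$ and every bounded operator $T:E\to W$ there is a bounded operator $V:Z\to W$ with $V\circ i=T$ and $\|V\|=\|T\|$. -/

import Mathlib

universe u

/-- `P` is a norm one projection of the normed space `F` onto its subspace `S`: `P` takes values
in `S`, is the identity on `S`, and is a contraction. If `S ≠ 0`, the norm of `P` is then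
exactly `1` (see `IsNormOneProjectionOnto.norm_eq_one`); the zero projection onto `S = 0` is
admitted. -/
structure IsNormOneProjectionOnto {𝕜 : Type} [RCLike 𝕜] {F : Type u} [NormedAddCommGroup F]
    [NormedSpace 𝕜 F] (P : F →L[𝕜] F) (S : Submodule 𝕜 F) : Prop where
  mem : ∀ x : F, P x ∈ S
  eq_self : ∀ x ∈ S, P x = x
  norm_le : ‖P‖ ≤ 1

theorem IsNormOneProjectionOnto.norm_eq_one {𝕜 : Type} [RCLike 𝕜] {F : Type u}
    [NormedAddCommGroup F] [NormedSpace 𝕜 F] {P : F →L[𝕜] F} {S : Submodule 𝕜 F}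
    (h : IsNormOneProjectionOnto P S) (hS : S ≠ ⊥) : ‖P‖ = 1 := by
  obtain ⟨x, hxS, hx⟩ := Submodule.exists_mem_ne_zero_of_ne_bot hS
  refine le_antisymm h.norm_le ?_
  have h1 := P.le_opNorm x
  rw [h.eq_self x hxS] at h1
  have h2 : 0 < ‖x‖ := norm_pos_iff.mpr hx
  nlinarith

/-- The double adjoint `T** : E** → F**` of a bounded operator `T : E → F`. -/
noncomputable def doubleAdjoint {𝕜 : Type} [RCLike 𝕜] {E F : Type u}
    [NormedAddCommGroup E] [NormedSpace 𝕜 E] [NormedAddCommGroup F] [NormedSpace 𝕜 F]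
    (T : E →L[𝕜] F) :
    StrongDual 𝕜 (StrongDual 𝕜 E) →L[𝕜] StrongDual 𝕜 (StrongDual 𝕜 F) :=
  ContinuousLinearMap.precomp 𝕜 (ContinuousLinearMap.precomp 𝕜 T)

theorem doubleAdjoint_apply {𝕜 : Type} [RCLike 𝕜] {E F : Type u}
    [NormedAddCommGroup E] [NormedSpace 𝕜 E] [NormedAddCommGroup F] [NormedSpace 𝕜 F]
    (T : E →L[𝕜] F) (φ : StrongDual 𝕜 (StrongDual 𝕜 E)) (f : StrongDual 𝕜 F) :
    doubleAdjoint T φ f = φ (f.comp T) := rfl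

/-- `X` is finitely representable in `Y`. -/
def FinitelyRepresentable (𝕜 : Type) [RCLike 𝕜] (X Y : Type u)
    [NormedAddCommGroup X] [NormedSpace 𝕜 X] [NormedAddCommGroup Y] [NormedSpace 𝕜 Y] : Prop :=
  ∀ ε : ℝ, 0 < ε → ∀ A : Submodule 𝕜 X, FiniteDimensional 𝕜 A →
    ∃ (B : Submodule 𝕜 Y) (v : A ≃L[𝕜] B),
      ‖(v : A →L[𝕜] B)‖ * ‖(v.symm : B →L[𝕜] A)‖ ≤ 1 + ε

/-- `X` and `Y` are finitely equivalent, i.e. `Y` belongs to the class `X^f`. -/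
def FinitelyEquivalent (𝕜 : Type) [RCLike 𝕜] (X Y : Type u)
    [NormedAddCommGroup X] [NormedSpace 𝕜 X] [NormedAddCommGroup Y] [NormedSpace 𝕜 Y] : Prop :=
  FinitelyRepresentable 𝕜 X Y ∧ FinitelyRepresentable 𝕜 Y X

/-- `E` is algebraically closed in the class `X^f`: for every isometric embedding `i` of `E` into
a Banach space `Z` of this class, there is a norm one projection of `Z**` onto `i**(E**)`. -/
def AlgebraicallyClosedIn (𝕜 : Type) [RCLike 𝕜] (X E : Type u)
    [NormedAddCommGroup X] [NormedSpace 𝕜 X] [NormedAddCommGroup E] [NormedSpace 𝕜 E] : Prop :=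
  ∀ (Z : Type u) [NormedAddCommGroup Z] [NormedSpace 𝕜 Z] [CompleteSpace Z],
    FinitelyEquivalent 𝕜 X Z → ∀ i : E →ₗᵢ[𝕜] Z,
      ∃ P : StrongDual 𝕜 (StrongDual 𝕜 Z) →L[𝕜] StrongDual 𝕜 (StrongDual 𝕜 Z),
        IsNormOneProjectionOnto (𝕜 := 𝕜) (F := StrongDual 𝕜 (StrongDual 𝕜 Z)) P
          (LinearMap.range (doubleAdjoint i.toContinuousLinearMap).toLinearMap)

/-- `E` is universally complemented in the class `X^f`: for every isometric embedding `i` of `E`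
into a Banach space `Z` of this class, there is a norm one projection of `Z` onto `i(E)`. -/
def UniversallyComplementedIn (𝕜 : Type) [RCLike 𝕜] (X E : Type u)
    [NormedAddCommGroup X] [NormedSpace 𝕜 X] [NormedAddCommGroup E] [NormedSpace 𝕜 E] : Prop :=
  ∀ (Z : Type u) [NormedAddCommGroup Z] [NormedSpace 𝕜 Z] [CompleteSpace Z],
    FinitelyEquivalent 𝕜 X Z → ∀ i : E →ₗᵢ[𝕜] Z,
      ∃ P : Z →L[𝕜] Z, IsNormOneProjectionOnto P (LinearMap.range i.toLinearMap)

/-- `E` is quasi-dual: there is a norm one projection of `E**` onto the canonical image of `E`. -/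
def QuasiDual (𝕜 : Type) [RCLike 𝕜] (E : Type u)
    [NormedAddCommGroup E] [NormedSpace 𝕜 E] : Prop :=
  ∃ P : StrongDual 𝕜 (StrongDual 𝕜 E) →L[𝕜] StrongDual 𝕜 (StrongDual 𝕜 E),
    IsNormOneProjectionOnto (𝕜 := 𝕜) (F := StrongDual 𝕜 (StrongDual 𝕜 E)) P
      (LinearMap.range (NormedSpace.inclusionInDoubleDual 𝕜 E).toLinearMap)

/-- Every bounded operator from `E` to a Banach space `W` extends, with the same norm, to every
Banach space `Z` of the class `X^f` that contains `E` isometrically. -/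
def ExtensionPropertyIn (𝕜 : Type) [RCLike 𝕜] (X E : Type u)
    [NormedAddCommGroup X] [NormedSpace 𝕜 X] [NormedAddCommGroup E] [NormedSpace 𝕜 E] : Prop :=
  ∀ (Z : Type u) [NormedAddCommGroup Z] [NormedSpace 𝕜 Z] [CompleteSpace Z],
    FinitelyEquivalent 𝕜 X Z → ∀ i : E →ₗᵢ[𝕜] Z,
      ∀ (W : Type u) [NormedAddCommGroup W] [NormedSpace 𝕜 W] [CompleteSpace W]
        (T : E →L[𝕜] W),
        ∃ V : Z →L[𝕜] W, (∀ x : E, V (i x) = T x) ∧ ‖V‖ = ‖T‖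

/-!
A norm one projection onto the range of an isometric embedding amounts to a left inverse of norm at
most one. Such left inverses compose and pass to double adjoints, so everything but quasi-duality
follows from the relation `i** ∘ J_E = J_Z ∘ i` for the canonical embeddings `J` into the biduals.

For quasi-duality it suffices to find a space `Z` in `X^f` and a contraction `S : E** → Z` that is
isometric on `J_E(E)`, for then a contractive left inverse of `S ∘ J_E`, composed with `S`, is one
of `J_E`. A Helly type form of local reflexivity maps finitely many elements of `E**` almost
contractively into `E`, almost fixing finitely many elements of `E`, and finite representability
carries `E` on into `X`. The limit of these maps takes values in an ultrapower of `X`, which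
belongs to `X^f`.
-/

open Filter Topology
open scoped ENNReal

-- At the default depth no operator norm is found for maps into or out of a bidual.
set_option maxSynthPendingDepth 3

section ContractiveLeftInverse

variable {𝕜 E F G : Type*} [NontriviallyNormedField 𝕜]
  [SeminormedAddCommGroup E] [NormedSpace 𝕜 E] [SeminormedAddCommGroup F] [NormedSpace 𝕜 F]
  [SeminormedAddCommGroup G] [NormedSpace 𝕜 G]

/-- The bounded operator `i` has a bounded left inverse of norm at most one. For an isometric
embedding `i` this says that there is a norm one projection onto the range of `i`. -/
def HasContractiveLeftInverse (i : E →L[𝕜] F) : Prop :=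
  ∃ p : F →L[𝕜] E, ‖p‖ ≤ 1 ∧ p.comp i = .id 𝕜 E

theorem norm_comp_le_one {f : F →L[𝕜] G} {g : E →L[𝕜] F} (hf : ‖f‖ ≤ 1) (hg : ‖g‖ ≤ 1) :
    ‖f.comp g‖ ≤ 1 :=
  (f.opNorm_comp_le g).trans (mul_le_one₀ hf (norm_nonneg g) hg)

theorem HasContractiveLeftInverse.comp {j : F →L[𝕜] G} {i : E →L[𝕜] F}
    (hj : HasContractiveLeftInverse j) (hi : HasContractiveLeftInverse i) :
    HasContractiveLeftInverse (j.comp i) := by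
  obtain ⟨q, hq, hqj⟩ := hj
  obtain ⟨p, hp, hpi⟩ := hi
  refine ⟨p.comp q, norm_comp_le_one hp hq, ?_⟩
  rw [ContinuousLinearMap.comp_assoc, ← q.comp_assoc, hqj, ContinuousLinearMap.id_comp, hpi]

theorem HasContractiveLeftInverse.of_comp {j : F →L[𝕜] G} {i : E →L[𝕜] F}
    (hji : HasContractiveLeftInverse (j.comp i)) (hj : ‖j‖ ≤ 1) :
    HasContractiveLeftInverse i := by
  obtain ⟨p, hp, hpji⟩ := hji
  exact ⟨p.comp j, norm_comp_le_one hp hj, hpji⟩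

end ContractiveLeftInverse

section NormOneProjection

variable {𝕜 : Type} [RCLike 𝕜] {E : Type*} {F : Type u} [NormedAddCommGroup E]
  [NormedSpace 𝕜 E] [NormedAddCommGroup F] [NormedSpace 𝕜 F]

theorem exists_isNormOneProjectionOnto_range_iff (i : E →ₗᵢ[𝕜] F) :
    (∃ P : F →L[𝕜] F, IsNormOneProjectionOnto P (LinearMap.range i.toLinearMap)) ↔
      HasContractiveLeftInverse i.toContinuousLinearMap := by
  constructor
  · rintro ⟨P, hP⟩
    refine ⟨(i.equivRange.symm : _ →L[𝕜] E).comp (P.codRestrict _ hP.mem), ?_, ?_⟩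
    · refine ContinuousLinearMap.opNorm_le_bound _ zero_le_one fun y => ?_
      exact (i.equivRange.symm.norm_map _).trans_le (P.le_of_opNorm_le hP.norm_le y)
    · ext x
      exact i.equivRange.symm_apply_eq.2 (Subtype.ext (hP.eq_self (i x) ⟨x, rfl⟩))
  · rintro ⟨p, hp, hpi⟩
    refine ⟨i.toContinuousLinearMap.comp p, fun y => ⟨p y, rfl⟩, ?_,
      norm_comp_le_one i.norm_toContinuousLinearMap_le hp⟩
    rintro _ ⟨x, rfl⟩
    exact congrArg i (DFunLike.congr_fun hpi x)

end NormOneProjection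

section DoubleAdjoint

theorem exists_strongDual_comp_linearIsometry_eq {𝕜 E F : Type*} [RCLike 𝕜]
    [NormedAddCommGroup E] [NormedSpace 𝕜 E] [NormedAddCommGroup F] [NormedSpace 𝕜 F]
    (i : E →ₗᵢ[𝕜] F) (f : StrongDual 𝕜 E) :
    ∃ g : StrongDual 𝕜 F, g.comp i.toContinuousLinearMap = f ∧ ‖g‖ = ‖f‖ := by
  obtain ⟨g, hg, hgf⟩ := exists_extension_norm_eq (LinearMap.range i.toLinearMap)
    (f.comp (i.equivRange.symm : _ →L[𝕜] E))
  refine ⟨g, ContinuousLinearMap.ext fun x => ?_,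
    hgf.trans (f.opNorm_comp_linearIsometryEquiv i.equivRange.symm)⟩
  exact (hg (i.equivRange x)).trans (congrArg f (i.equivRange.symm_apply_apply x))

variable {𝕜 : Type} [RCLike 𝕜] {E F : Type u} [NormedAddCommGroup E] [NormedSpace 𝕜 E]
  [NormedAddCommGroup F] [NormedSpace 𝕜 F]

theorem norm_doubleAdjoint_le (T : E →L[𝕜] F) : ‖doubleAdjoint T‖ ≤ ‖T‖ := by
  refine ContinuousLinearMap.opNorm_le_bound _ (norm_nonneg _) fun φ => ?_
  refine ContinuousLinearMap.opNorm_le_bound _ (by positivity) fun f => ?_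
  calc ‖φ (f.comp T)‖ ≤ ‖φ‖ * (‖f‖ * ‖T‖) :=
        φ.le_of_opNorm_le_of_le le_rfl (f.opNorm_comp_le T)
    _ = ‖T‖ * ‖φ‖ * ‖f‖ := by ring

theorem doubleAdjoint_comp_inclusionInDoubleDual (T : E →L[𝕜] F) :
    (doubleAdjoint T).comp (NormedSpace.inclusionInDoubleDual 𝕜 E) =
      (NormedSpace.inclusionInDoubleDual 𝕜 F).comp T :=
  rfl

theorem HasContractiveLeftInverse.doubleAdjoint {i : E →L[𝕜] F}
    (hi : HasContractiveLeftInverse i) : HasContractiveLeftInverse (doubleAdjoint i) := by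
  obtain ⟨p, hp, hpi⟩ := hi
  refine ⟨_root_.doubleAdjoint p, (norm_doubleAdjoint_le p).trans hp, ?_⟩
  ext φ f
  have hf : (f.comp p).comp i = f := by rw [ContinuousLinearMap.comp_assoc, hpi, f.comp_id]
  exact congrArg φ hf

/-- The double adjoint of an isometric embedding, as an isometric embedding of the biduals. -/
noncomputable def doubleAdjointLinearIsometry (i : E →ₗᵢ[𝕜] F) :
    StrongDual 𝕜 (StrongDual 𝕜 E) →ₗᵢ[𝕜] StrongDual 𝕜 (StrongDual 𝕜 F) where
  toLinearMap := (doubleAdjoint i.toContinuousLinearMap).toLinearMap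
  norm_map' φ := by
    refine le_antisymm ?_ (ContinuousLinearMap.opNorm_le_bound _ (by positivity) fun f => ?_)
    · exact ((doubleAdjoint i.toContinuousLinearMap).le_of_opNorm_le
        ((norm_doubleAdjoint_le _).trans i.norm_toContinuousLinearMap_le) φ).trans_eq (one_mul _)
    · obtain ⟨g, rfl, hg⟩ := exists_strongDual_comp_linearIsometry_eq i f
      rw [← hg]
      exact (doubleAdjoint i.toContinuousLinearMap φ).le_opNorm g

end DoubleAdjoint

section LocalReflexivity

open RCLike

theorem exists_strongDual_re_neg_of_disjoint_submodule {𝕜 V : Type*} [RCLike 𝕜]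
    [TopologicalSpace V] [AddCommGroup V] [IsTopologicalAddGroup V] [Module 𝕜 V]
    [ContinuousSMul 𝕜 V] [Module ℝ V] [IsScalarTower ℝ 𝕜 V] {C : Set V} (hconv : Convex ℝ C)
    (hopen : IsOpen C) {M : Submodule 𝕜 V} (hdisj : Disjoint C (M : Set V)) :
    ∃ f : StrongDual 𝕜 V, (∀ m ∈ M, f m = 0) ∧ ∀ c ∈ C, re (f c) < 0 := by
  obtain ⟨f, b, hfC, hfM⟩ := RCLike.geometric_hahn_banach_open (𝕜 := 𝕜) hconv hopen
    (M.restrictScalars ℝ).convex hdisj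
  have hb : b ≤ 0 := by simpa using hfM 0 (zero_mem M)
  refine ⟨f, fun m hm => ?_, fun c hc => (hfC c hc).trans_le hb⟩
  by_contra hne
  have h : b ≤ b - 1 := by
    simpa [hne, mul_assoc] using hfM ((((b - 1 : ℝ) : 𝕜) * (f m)⁻¹) • m) (M.smul_mem _ hm)
  linarith

theorem sum_bilin_eq_zero_of_forall_dual {K V W N ι : Type*} [Field K] [AddCommGroup V]
    [Module K V] [AddCommGroup W] [Module K W] [AddCommGroup N] [Module K N] [Fintype ι]
    (B : V →ₗ[K] W →ₗ[K] N) {v : ι → V} {w : ι → W}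
    (h : ∀ l : Module.Dual K V, ∑ i, l (v i) • w i = 0) : ∑ i, B (v i) (w i) = 0 := by
  classical
  let b := Module.Basis.ofVectorSpace K V
  have htensor : ∑ i, v i ⊗ₜ[K] w i = 0 := by
    apply (TensorProduct.equivFinsuppOfBasisLeft b).injective
    ext j
    simpa using h (b.coord j)
  simpa using congrArg (TensorProduct.lift B) htensor

section

variable {𝕜 E : Type*} [RCLike 𝕜] [NormedAddCommGroup E] [NormedSpace 𝕜 E]

theorem exists_norm_lt_apply_eq {ψ : StrongDual 𝕜 (StrongDual 𝕜 E)} {r : ℝ} (hr : ‖ψ‖ < r)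
    (g : StrongDual 𝕜 E) : ∃ x : E, ‖x‖ < r ∧ g x = ψ g := by
  have hr0 : 0 < r := (norm_nonneg ψ).trans_lt hr
  rcases eq_or_ne (ψ g) 0 with hψg | hψg
  · exact ⟨0, by simpa using hr0, by simp [hψg]⟩
  have hlt : ‖ψ g‖ / r < ‖g‖ := by
    have hg : 0 < ‖g‖ := norm_pos_iff.2 fun hg => hψg (by rw [hg, map_zero])
    rw [div_lt_iff₀ hr0, mul_comm]
    exact (ψ.le_opNorm g).trans_lt (mul_lt_mul_of_pos_right hr hg)
  obtain ⟨y, hy, hgy⟩ := g.exists_lt_apply_of_lt_opNorm hlt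
  have hgy0 : 0 < ‖g y‖ := (by positivity : 0 ≤ ‖ψ g‖ / r).trans_lt hgy
  refine ⟨(ψ g / g y) • y, ?_, ?_⟩
  · calc ‖(ψ g / g y) • y‖ = ‖ψ g‖ / ‖g y‖ * ‖y‖ := by rw [norm_smul, norm_div]
      _ ≤ ‖ψ g‖ / ‖g y‖ := mul_le_of_le_one_right (by positivity) hy.le
      _ < r := (div_lt_comm₀ hr0 hgy0).1 hgy
  · rw [map_smul, smul_eq_mul, div_mul_cancel₀ _ (norm_pos_iff.1 hgy0)]

theorem exists_mem_norm_sub_lt_of_bidual {ι : Type*} [Fintype ι] {M : Submodule 𝕜 (ι → E)}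
    {φ : ι → StrongDual 𝕜 (StrongDual 𝕜 E)}
    (hφ : ∀ g : ι → StrongDual 𝕜 E, (∀ m ∈ M, ∑ i, g i (m i) = 0) → ∑ i, φ i (g i) = 0)
    (x : ι → E) {ε : ℝ} (hε : 0 < ε) :
    ∃ m ∈ M, ∀ i, ‖m i - x i‖ < ‖φ i - NormedSpace.inclusionInDoubleDual 𝕜 E (x i)‖ + ε := by
  classical
  let _ : NormedSpace ℝ E := NormedSpace.restrictScalars ℝ 𝕜 E
  have : IsScalarTower ℝ 𝕜 E := RestrictScalars.isScalarTower ℝ 𝕜 E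
  let r : ι → ℝ := fun i => ‖φ i - NormedSpace.inclusionInDoubleDual 𝕜 E (x i)‖ + ε
  by_contra! hM
  have hdisj : Disjoint (Set.univ.pi fun i => Metric.ball (x i) (r i)) (M : Set (ι → E)) := by
    refine Set.disjoint_right.2 fun m hm hmC => ?_
    obtain ⟨i, hi⟩ := hM m hm
    exact hi.not_gt (mem_ball_iff_norm.1 (hmC i (Set.mem_univ i)))
  obtain ⟨f, hfM, hfC⟩ := exists_strongDual_re_neg_of_disjoint_submodule (𝕜 := 𝕜)
    (convex_pi fun i _ => convex_ball (x i) (r i))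
    (isOpen_set_pi Set.finite_univ fun i _ => Metric.isOpen_ball) hdisj
  let g : ι → StrongDual 𝕜 E := fun i => f.comp (.single 𝕜 (fun _ => E) i)
  have hfg (y : ι → E) : f y = ∑ i, g i (y i) := (ContinuousLinearMap.sum_comp_single 𝕜 _ f y).symm
  have hφg : ∑ i, φ i (g i) = 0 := hφ g fun m hm => (hfg m).symm.trans (hfM m hm)
  choose v hv hgv using fun i => exists_norm_lt_apply_eq (lt_add_of_pos_right
    ‖φ i - NormedSpace.inclusionInDoubleDual 𝕜 E (x i)‖ hε) (g i)
  have hgxv (i : ι) : g i (x i + v i) = φ i (g i) := by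
    rw [map_add, hgv, sub_apply, NormedSpace.dual_def, add_sub_cancel]
  have hxv : f (x + v) = 0 := by
    rw [hfg, ← hφg]
    exact Finset.sum_congr rfl fun i _ => hgxv i
  have hneg := hfC (x + v) fun i _ => by simpa using hv i
  simp [hxv] at hneg

theorem exists_linearMap_bidual_norm_sub_lt {ι : Type*} [Finite ι]
    (φ : ι → StrongDual 𝕜 (StrongDual 𝕜 E)) (x : ι → E) {ε : ℝ} (hε : 0 < ε) :
    ∃ u : StrongDual 𝕜 (StrongDual 𝕜 E) →ₗ[𝕜] E, ∀ i,
      ‖u (φ i) - x i‖ < ‖φ i - NormedSpace.inclusionInDoubleDual 𝕜 E (x i)‖ + ε := by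
  have := Fintype.ofFinite ι
  let A : (StrongDual 𝕜 (StrongDual 𝕜 E) →ₗ[𝕜] E) →ₗ[𝕜] (ι → E) :=
    LinearMap.pi fun i => LinearMap.applyₗ (φ i)
  have hA (g : ι → StrongDual 𝕜 E) (hg : ∀ m ∈ LinearMap.range A, ∑ i, g i (m i) = 0) :
      ∑ i, φ i (g i) = 0 := by
    -- Testing on the rank one operators `l.smulRight e` gives `∑ i, l (φ i) • g i = 0`.
    refine sum_bilin_eq_zero_of_forall_dual (ContinuousLinearMap.coeLM 𝕜 :
      StrongDual 𝕜 (StrongDual 𝕜 E) →ₗ[𝕜] StrongDual 𝕜 E →ₗ[𝕜] 𝕜) fun l => ?_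
    ext e
    simpa [A] using hg _ ⟨l.smulRight e, rfl⟩
  obtain ⟨_, ⟨u, rfl⟩, hu⟩ := exists_mem_norm_sub_lt_of_bidual hA x hε
  exact ⟨u, hu⟩

theorem exists_linearMap_bidual_norm_lt_add (s : Finset (StrongDual 𝕜 (StrongDual 𝕜 E)))
    (t : Finset E) {ε : ℝ} (hε : 0 < ε) :
    ∃ u : StrongDual 𝕜 (StrongDual 𝕜 E) →ₗ[𝕜] E, (∀ φ ∈ s, ‖u φ‖ < ‖φ‖ + ε) ∧
      ∀ x ∈ t, ‖u (NormedSpace.inclusionInDoubleDual 𝕜 E x) - x‖ < ε := by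
  obtain ⟨u, hu⟩ := exists_linearMap_bidual_norm_sub_lt (ι := s ⊕ t)
    (Sum.elim (↑) fun x => NormedSpace.inclusionInDoubleDual 𝕜 E x) (Sum.elim 0 (↑)) hε
  refine ⟨u, fun φ hφ => ?_, fun x hx => ?_⟩
  · simpa using hu (.inl ⟨φ, hφ⟩)
  · simpa using hu (.inr ⟨x, hx⟩)

end

end LocalReflexivity

section FiniteRepresentability

variable {𝕜 : Type} [RCLike 𝕜] {X Y : Type u} [NormedAddCommGroup X] [NormedSpace 𝕜 X]
  [NormedAddCommGroup Y] [NormedSpace 𝕜 Y]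

theorem FinitelyRepresentable.exists_linearMap_norm_le (h : FinitelyRepresentable 𝕜 X Y)
    {ε : ℝ} (hε : 0 < ε) (A : Submodule 𝕜 X) [FiniteDimensional 𝕜 A] :
    ∃ v : X →ₗ[𝕜] Y, ∀ x ∈ A, ‖v x‖ ≤ ‖x‖ ∧ ‖x‖ ≤ (1 + ε) * ‖v x‖ := by
  obtain ⟨B, e, he⟩ := h ε hε A ‹_›
  set c := ‖(e : A →L[𝕜] B)‖
  obtain ⟨v, hv⟩ := LinearMap.exists_extend
    (((c⁻¹ : ℝ) : 𝕜) • (B.subtype ∘ₗ (e : A →ₗ[𝕜] B)))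
  refine ⟨v, fun x hx => ?_⟩
  lift x to A using hx
  have hvx : ‖v x‖ = c⁻¹ * ‖e x‖ := by
    have hvex : v x = ((c⁻¹ : ℝ) : 𝕜) • (e x : Y) := LinearMap.congr_fun hv x
    rw [hvex, norm_smul, RCLike.norm_of_nonneg (by positivity), B.coe_norm]
  have hle : ‖e x‖ ≤ c * ‖x‖ := (e : A →L[𝕜] B).le_opNorm x
  have hge : ‖x‖ ≤ ‖(e.symm : B →L[𝕜] A)‖ * ‖e x‖ := by
    simpa using (e.symm : B →L[𝕜] A).le_opNorm (e x)
  rw [hvx, ← A.coe_norm]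
  rcases (norm_nonneg _ : 0 ≤ c).eq_or_lt with hc | hc
  · have hex : ‖e x‖ = 0 :=
      le_antisymm (hle.trans_eq (mul_eq_zero_of_left hc.symm _)) (norm_nonneg _)
    simpa [hex] using hge
  · refine ⟨(inv_mul_le_iff₀ hc).2 hle, hge.trans ?_⟩
    rw [← mul_assoc, ← div_eq_mul_inv]
    gcongr
    rwa [le_div_iff₀' hc]

theorem finitelyRepresentable_of_forall_exists_linearMap
    (h : ∀ ε : ℝ, 0 < ε → ∀ A : Submodule 𝕜 X, FiniteDimensional 𝕜 A →
      ∃ v : A →ₗ[𝕜] Y, ∀ x, |‖v x‖ - ‖x‖| ≤ ε * ‖x‖) :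
    FinitelyRepresentable 𝕜 X Y := by
  intro ε hε A hA
  -- This choice gives `(1 + δ) / (1 - δ) = 1 + ε`.
  set δ := ε / (2 + ε) with hδ
  have hδ0 : 0 < δ := by positivity
  have hδ1 : 0 < 1 - δ := sub_pos.2 ((div_lt_one (by positivity)).2 (by linarith))
  obtain ⟨v, hv⟩ := h δ hδ0 A hA
  have hle (x : A) : ‖v x‖ ≤ (1 + δ) * ‖x‖ := by linarith [(abs_le.1 (hv x)).2]
  have hge (x : A) : (1 - δ) * ‖x‖ ≤ ‖v x‖ := by linarith [(abs_le.1 (hv x)).1]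
  have hinj : Function.Injective v := by
    refine (injective_iff_map_eq_zero v).2 fun x hx => norm_le_zero_iff.1 ?_
    exact nonpos_of_mul_nonpos_right (by simpa [hx] using hge x) hδ1
  let e := (LinearEquiv.ofInjective v hinj).toContinuousLinearEquiv
  have he : ‖(e : A →L[𝕜] LinearMap.range v)‖ ≤ 1 + δ :=
    ContinuousLinearMap.opNorm_le_bound _ (by positivity) hle
  have hesymm : ‖(e.symm : LinearMap.range v →L[𝕜] A)‖ ≤ (1 - δ)⁻¹ := by
    refine ContinuousLinearMap.opNorm_le_bound _ (by positivity) fun y => ?_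
    rw [inv_mul_eq_div, le_div_iff₀' hδ1]
    exact (hge (e.symm y)).trans_eq
      (congrArg (norm : LinearMap.range v → ℝ) (e.apply_symm_apply y))
  refine ⟨_, e, (mul_le_mul he hesymm (norm_nonneg _) (by positivity)).trans_eq ?_⟩
  rw [mul_inv_eq_iff_eq_mul₀ hδ1.ne', hδ]
  field

theorem finitelyRepresentable_of_linearIsometry (i : X →ₗᵢ[𝕜] Y) : FinitelyRepresentable 𝕜 X Y := by
  refine finitelyRepresentable_of_forall_exists_linearMap fun ε hε A _ =>
    ⟨(i.comp A.subtypeₗᵢ).toLinearMap, fun x => ?_⟩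
  rw [LinearIsometry.coe_toLinearMap, LinearIsometry.norm_map, sub_self, abs_zero]
  positivity

end FiniteRepresentability

section Ultrapower

section

variable {𝕜 A X ι : Type*} [RCLike 𝕜] [NormedAddCommGroup A] [NormedSpace 𝕜 A]
  [FiniteDimensional 𝕜 A] [SeminormedAddCommGroup X] [NormedSpace 𝕜 X]

theorem eventually_forall_abs_norm_sub_le {l : Filter ι} {u : ι → A →L[𝕜] X} {C : ℝ}
    (hu : ∀ i, ‖u i‖ ≤ C) (hlim : ∀ a, Tendsto (fun i => ‖u i a‖) l (𝓝 ‖a‖)) {δ : ℝ}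
    (hδ : 0 < δ) : ∀ᶠ i in l, ∀ a, |‖u i a‖ - ‖a‖| ≤ δ * ‖a‖ := by
  have : ProperSpace A := FiniteDimensional.proper 𝕜 A
  let F (i : ι) (a : Metric.sphere (0 : A) 1) : ℝ := ‖u i a‖
  have hF : UniformEquicontinuous F := by
    refine LipschitzWith.uniformEquicontinuous F C.toNNReal fun i => .of_dist_le_mul fun a b => ?_
    calc |‖u i a‖ - ‖u i b‖| ≤ ‖u i a - u i b‖ := abs_norm_sub_norm_le _ _
      _ = ‖u i (a - b)‖ := by rw [map_sub]
      _ ≤ C.toNNReal * ‖(a - b : A)‖ := (u i).le_of_opNorm_le ((hu i).trans C.le_coe_toNNReal) _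
      _ = C.toNNReal * dist a b := by rw [Subtype.dist_eq, dist_eq_norm]
  have hunif : TendstoUniformly F (fun a => ‖(a : A)‖) l :=
    UniformFun.tendsto_iff_tendstoUniformly.1 <|
      (hF.equicontinuous.tendsto_uniformFun_iff_pi l _).2 <| tendsto_pi_nhds.2 fun a => hlim a
  filter_upwards [Metric.tendstoUniformly_iff.1 hunif δ hδ] with i hi a
  rcases eq_or_ne a 0 with rfl | ha
  · simp
  have hunit := (hi ⟨((‖a‖⁻¹ : ℝ) : 𝕜) • a, by simp [norm_smul, ha]⟩).le
  have hscale : ‖a‖⁻¹ * |‖u i a‖ - ‖a‖| ≤ δ := by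
    rw [← abs_of_nonneg (inv_nonneg.2 (norm_nonneg a)), ← abs_mul, mul_sub, abs_sub_comm]
    simpa [F, Real.dist_eq, norm_smul] using hunit
  rwa [inv_mul_le_iff₀' (norm_pos_iff.2 ha)] at hscale

end

section

variable (𝕜 : Type*) {I : Type*} (X : Type*) [NormedField 𝕜] [NormedAddCommGroup X]
  [NormedSpace 𝕜 X]

/-- The bounded families in `X` that tend to `0` along the filter `U`: the subspace of `ℓ^∞(I, X)`
by which one divides to obtain the ultrapower. -/
def nullFamilies (U : Filter I) : Submodule 𝕜 (lp (fun _ : I => X) ∞) where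
  carrier := {x | Tendsto (fun i => x i) U (𝓝 0)}
  zero_mem' := tendsto_const_nhds
  add_mem' {x y} hx hy := by simpa using Tendsto.add hx hy
  smul_mem' c x hx := by simpa using Tendsto.const_smul hx c

variable {X}

theorem mem_nullFamilies {U : Filter I} {x : lp (fun _ : I => X) ∞} :
    x ∈ nullFamilies 𝕜 X U ↔ Tendsto (fun i => x i) U (𝓝 0) :=
  Iff.rfl

variable (X)

instance isClosed_nullFamilies (U : Filter I) :
    IsClosed (nullFamilies 𝕜 X U : Set (lp (fun _ : I => X) ∞)) := by
  refine isClosed_of_closure_subset fun x hx => NormedAddGroup.tendsto_nhds_zero.2 fun ε hε => ?_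
  obtain ⟨y, hy, hxy⟩ := SeminormedAddCommGroup.mem_closure_iff.1 hx (ε / 2) (half_pos hε)
  have hyε := NormedAddGroup.tendsto_nhds_zero.1 ((mem_nullFamilies 𝕜).1 hy) (ε / 2) (half_pos hε)
  filter_upwards [hyε] with i hi
  calc ‖x i‖ ≤ ‖y i‖ + ‖x i - y i‖ := norm_le_norm_add_norm_sub' _ _
    _ ≤ ‖y i‖ + ‖x - y‖ := by gcongr; exact lp.norm_apply_le_norm ENNReal.top_ne_zero (x - y) i
    _ < ε / 2 + ε / 2 := add_lt_add hi hxy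
    _ = ε := add_halves ε

/-- The ultrapower of the Banach space `X` with respect to `U`, as a quotient of `ℓ^∞(I, X)`. -/
abbrev BanachUltrapower (U : Ultrafilter I) : Type _ :=
  lp (fun _ : I => X) ∞ ⧸ nullFamilies 𝕜 X (U : Filter I)

variable {X}

theorem mkQ_nullFamilies_congr {U : Filter I} {x y : lp (fun _ : I => X) ∞}
    (h : ∀ᶠ i in U, x i = y i) : (nullFamilies 𝕜 X U).mkQ x = (nullFamilies 𝕜 X U).mkQ y := by
  refine (Submodule.Quotient.eq _).2 (tendsto_const_nhds.congr' ?_)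
  filter_upwards [h] with i hi
  exact (sub_eq_zero.2 hi).symm

theorem exists_lp_infty_eventuallyEq {l : Filter I} {x : I → X} {C : ℝ} (hC : 0 ≤ C)
    (hx : ∀ᶠ i in l, ‖x i‖ ≤ C) :
    ∃ y : lp (fun _ : I => X) ∞, ‖y‖ ≤ C ∧ ∀ᶠ i in l, y i = x i := by
  have hle (i : I) : ‖{i | ‖x i‖ ≤ C}.indicator x i‖ ≤ C := by
    by_cases hi : ‖x i‖ ≤ C
    · simp [hi]
    · simpa [hi] using hC
  refine ⟨⟨{i | ‖x i‖ ≤ C}.indicator x, memℓp_infty ⟨C, Set.forall_mem_range.2 hle⟩⟩,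
    lp.norm_le_of_forall_le hC hle, ?_⟩
  filter_upwards [hx] with i hi
  exact Set.indicator_of_mem (s := {i | ‖x i‖ ≤ C}) hi x

theorem norm_mkQ_nullFamilies_le {U : Filter I} {x : lp (fun _ : I => X) ∞} {C : ℝ} (hC : 0 ≤ C)
    (hx : ∀ᶠ i in U, ‖x i‖ ≤ C) : ‖(nullFamilies 𝕜 X U).mkQ x‖ ≤ C := by
  obtain ⟨y, hy, hyx⟩ := exists_lp_infty_eventuallyEq hC hx
  rw [← mkQ_nullFamilies_congr 𝕜 hyx]
  exact (Submodule.Quotient.norm_mk_le _ y).trans hy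

theorem eventually_norm_lt_of_norm_mkQ_nullFamilies_lt {U : Filter I}
    {x : lp (fun _ : I => X) ∞} {C : ℝ}
    (hx : ‖(nullFamilies 𝕜 X U).mkQ x‖ < C) : ∀ᶠ i in U, ‖x i‖ < C := by
  obtain ⟨y, hy, hyC⟩ :=
    Submodule.Quotient.norm_mk_lt ((nullFamilies 𝕜 X U).mkQ x) (sub_pos.2 hx)
  have hxy : x - y ∈ nullFamilies 𝕜 X U := (Submodule.Quotient.eq _).1 hy.symm
  rw [add_sub_cancel] at hyC
  have hxyC := ((mem_nullFamilies 𝕜).1 hxy).norm.eventually_lt_const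
    (norm_zero.trans_lt (sub_pos.2 hyC))
  filter_upwards [hxyC] with i hi
  calc ‖x i‖ ≤ ‖y i‖ + ‖x i - y i‖ := norm_le_norm_add_norm_sub' _ _
    _ < ‖y‖ + (C - ‖y‖) := add_lt_add_of_le_of_lt (lp.norm_apply_le_norm ENNReal.top_ne_zero y i) hi
    _ = C := add_sub_cancel _ _

theorem tendsto_norm_mkQ_nullFamilies (U : Ultrafilter I) (x : lp (fun _ : I => X) ∞) :
    Tendsto (fun i => ‖x i‖) U (𝓝 ‖(nullFamilies 𝕜 X (U : Filter I)).mkQ x‖) := by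
  refine tendsto_order.2 ⟨fun a ha => ?_, fun b hb =>
    eventually_norm_lt_of_norm_mkQ_nullFamilies_lt 𝕜 hb⟩
  by_contra hle
  simp only [← Ultrafilter.eventually_not, not_lt] at hle
  obtain ⟨i, hi⟩ := hle.exists
  exact ha.not_ge (norm_mkQ_nullFamilies_le 𝕜 ((norm_nonneg _).trans hi) hle)

theorem exists_linearMap_ultrapower_tendsto_norm {F : Type*} [AddCommGroup F] [Module 𝕜 F]
    (U : Ultrafilter I) (w : I → F →ₗ[𝕜] X) (hw : ∀ φ, ∃ C, ∀ᶠ i in (U : Filter I), ‖w i φ‖ ≤ C) :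
    ∃ S : F →ₗ[𝕜] BanachUltrapower 𝕜 X U, ∀ φ, Tendsto (fun i => ‖w i φ‖) U (𝓝 ‖S φ‖) := by
  choose C hC using hw
  have hC0 (φ : F) : 0 ≤ C φ := (hC φ).exists.elim fun _ => (norm_nonneg _).trans
  choose y _ hyw using fun φ => exists_lp_infty_eventuallyEq (hC0 φ) (hC φ)
  let S : F →ₗ[𝕜] BanachUltrapower 𝕜 X U :=
    { toFun := fun φ => (nullFamilies 𝕜 X (U : Filter I)).mkQ (y φ)
      map_add' := fun φ ψ => by
        rw [← map_add]
        refine mkQ_nullFamilies_congr 𝕜 ?_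
        filter_upwards [hyw φ, hyw ψ, hyw (φ + ψ)] with i h₁ h₂ h₃
        simp [h₁, h₂, h₃]
      map_smul' := fun c φ => by
        rw [← map_smul]
        refine mkQ_nullFamilies_congr 𝕜 ?_
        filter_upwards [hyw φ, hyw (c • φ)] with i h₁ h₂
        simp [h₁, h₂] }
  refine ⟨S, fun φ => (tendsto_norm_mkQ_nullFamilies 𝕜 U (y φ)).congr' ?_⟩
  filter_upwards [hyw φ] with i hi
  rw [hi]

end

section

variable {𝕜 : Type} [RCLike 𝕜] {I X : Type u} [NormedAddCommGroup X] [NormedSpace 𝕜 X]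

theorem finitelyRepresentable_ultrapower_right (U : Ultrafilter I) :
    FinitelyRepresentable 𝕜 X (BanachUltrapower 𝕜 X U) := by
  obtain ⟨S, hS⟩ := exists_linearMap_ultrapower_tendsto_norm 𝕜 U (fun _ : I => (.id : X →ₗ[𝕜] X))
    fun x => ⟨‖x‖, .of_forall fun _ => le_rfl⟩
  exact finitelyRepresentable_of_linearIsometry
    ⟨S, fun x => tendsto_nhds_unique (hS x) tendsto_const_nhds⟩

theorem finitelyRepresentable_ultrapower_left (U : Ultrafilter I) :
    FinitelyRepresentable 𝕜 (BanachUltrapower 𝕜 X U) X := by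
  obtain ⟨σ, hσ⟩ := LinearMap.exists_rightInverse_of_surjective
    (nullFamilies 𝕜 X (U : Filter I)).mkQ (Submodule.range_mkQ _)
  refine finitelyRepresentable_of_forall_exists_linearMap fun ε hε A _ => ?_
  let s : A →L[𝕜] lp (fun _ : I => X) ∞ := (σ ∘ₗ A.subtype).toContinuousLinearMap
  let u (i : I) : A →L[𝕜] X := (lp.evalCLM 𝕜 (fun _ => X) ∞ i).comp s
  have hu (i : I) : ‖u i‖ ≤ ‖s‖ :=
    ContinuousLinearMap.opNorm_le_bound _ (norm_nonneg s) fun a =>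
      (lp.norm_apply_le_norm ENNReal.top_ne_zero (s a) i).trans (s.le_opNorm a)
  have hlim (a : A) : Tendsto (fun i => ‖u i a‖) U (𝓝 ‖a‖) := by
    have hsa : (nullFamilies 𝕜 X (U : Filter I)).mkQ (s a) = a := LinearMap.congr_fun hσ a
    rw [A.coe_norm, ← hsa]
    exact tendsto_norm_mkQ_nullFamilies 𝕜 U (s a)
  obtain ⟨i, hi⟩ := (eventually_forall_abs_norm_sub_le hu hlim hε).exists
  exact ⟨u i, hi⟩

theorem finitelyEquivalent_ultrapower (U : Ultrafilter I) :
    FinitelyEquivalent 𝕜 X (BanachUltrapower 𝕜 X U) :=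
  ⟨finitelyRepresentable_ultrapower_right U, finitelyRepresentable_ultrapower_left U⟩

end

end Ultrapower

section BidualInUltrapower

variable {𝕜 : Type} [RCLike 𝕜] {X E : Type u} [NormedAddCommGroup X] [NormedSpace 𝕜 X]
  [NormedAddCommGroup E] [NormedSpace 𝕜 E]

theorem FinitelyRepresentable.exists_linearMap_bidual (h : FinitelyRepresentable 𝕜 E X)
    (s : Finset (StrongDual 𝕜 (StrongDual 𝕜 E))) (t : Finset E) {ε : ℝ} (hε : 0 < ε) :
    ∃ w : StrongDual 𝕜 (StrongDual 𝕜 E) →ₗ[𝕜] X, (∀ φ ∈ s, ‖w φ‖ ≤ ‖φ‖ + ε) ∧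
      ∀ x ∈ t, ‖x‖ - ε ≤ (1 + ε) * ‖w (NormedSpace.inclusionInDoubleDual 𝕜 E x)‖ := by
  obtain ⟨u, hus, hut⟩ := exists_linearMap_bidual_norm_lt_add s t hε
  let G : Set E := u '' s ∪ (fun x => u (NormedSpace.inclusionInDoubleDual 𝕜 E x)) '' t
  have hG : G.Finite := (s.finite_toSet.image _).union (t.finite_toSet.image _)
  have := FiniteDimensional.span_of_finite 𝕜 hG
  obtain ⟨v, hv⟩ := h.exists_linearMap_norm_le hε (Submodule.span 𝕜 G)
  refine ⟨v ∘ₗ u, fun φ hφ => ?_, fun x hx => ?_⟩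
  · exact (hv _ (Submodule.subset_span (.inl ⟨φ, hφ, rfl⟩))).1.trans (hus φ hφ).le
  · have hle := (hv _ (Submodule.subset_span (.inr ⟨x, hx, rfl⟩))).2
    have hsub := norm_sub_norm_le x (u (NormedSpace.inclusionInDoubleDual 𝕜 E x))
    rw [norm_sub_rev] at hsub
    rw [LinearMap.comp_apply]
    linarith [hut x hx]

theorem FinitelyRepresentable.exists_contraction_bidual_ultrapower
    (h : FinitelyRepresentable 𝕜 E X) :
    ∃ (I : Type u) (U : Ultrafilter I)
      (S : StrongDual 𝕜 (StrongDual 𝕜 E) →L[𝕜] BanachUltrapower 𝕜 X U), ‖S‖ ≤ 1 ∧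
        ∀ x, ‖S (NormedSpace.inclusionInDoubleDual 𝕜 E x)‖ = ‖x‖ := by
  classical
  let I := Finset (StrongDual 𝕜 (StrongDual 𝕜 E)) × Finset E × ℕ
  let U : Ultrafilter I := .of atTop
  let ε (i : I) : ℝ := 1 / (i.2.2 + 1)
  have hU : (U : Filter I) ≤ atTop := Ultrafilter.of_le _
  have hsnd : Tendsto (fun i : I => i.2.2) atTop atTop :=
    tendsto_atTop.2 fun n => (eventually_ge_atTop (∅, ∅, n)).mono fun _ hi => hi.2.2
  have hε : Tendsto ε U (𝓝 0) :=
    tendsto_one_div_add_atTop_nhds_zero_nat.comp (hsnd.mono_left hU)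
  choose w hws hwt using fun i : I => h.exists_linearMap_bidual i.1 i.2.1
    (Nat.one_div_pos_of_nat : 0 < 1 / ((i.2.2 : ℝ) + 1))
  have hle (φ : StrongDual 𝕜 (StrongDual 𝕜 E)) : ∀ᶠ i in U, ‖w i φ‖ ≤ ‖φ‖ + ε i := by
    filter_upwards [hU (eventually_ge_atTop ({φ}, ∅, 0))] with i hi
    exact hws i φ (hi.1 (Finset.mem_singleton_self φ))
  have hge (x : E) : ∀ᶠ i in U,
      ‖x‖ - ε i ≤ (1 + ε i) * ‖w i (NormedSpace.inclusionInDoubleDual 𝕜 E x)‖ := by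
    filter_upwards [hU (eventually_ge_atTop (∅, {x}, 0))] with i hi
    exact hwt i x (hi.2.1 (Finset.mem_singleton_self x))
  have hadd (φ : StrongDual 𝕜 (StrongDual 𝕜 E)) : Tendsto (fun i => ‖φ‖ + ε i) U (𝓝 ‖φ‖) := by
    simpa using tendsto_const_nhds.add hε
  obtain ⟨S, hS⟩ := exists_linearMap_ultrapower_tendsto_norm 𝕜 U w fun φ => ⟨‖φ‖ + 1, by
    filter_upwards [hle φ, hε.eventually_le_const one_pos] with i hi hi'
    linarith⟩
  have hSle (φ : StrongDual 𝕜 (StrongDual 𝕜 E)) : ‖S φ‖ ≤ ‖φ‖ :=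
    le_of_tendsto_of_tendsto (hS φ) (hadd φ) (hle φ)
  refine ⟨I, U, S.mkContinuous 1 fun φ => (hSle φ).trans_eq (one_mul _).symm,
    S.mkContinuous_norm_le zero_le_one _, fun x => ?_⟩
  refine le_antisymm ((hSle _).trans (NormedSpace.double_dual_bound 𝕜 E x)) ?_
  have hlim := (hε.const_add 1).mul (hS (NormedSpace.inclusionInDoubleDual 𝕜 E x))
  simpa using le_of_tendsto_of_tendsto (tendsto_const_nhds.sub hε) hlim (hge x)

end BidualInUltrapower

section Complementation

variable {𝕜 : Type} [RCLike 𝕜] {X E : Type u} [NormedAddCommGroup X] [NormedSpace 𝕜 X]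
  [NormedAddCommGroup E] [NormedSpace 𝕜 E]

theorem universallyComplementedIn_iff_hasContractiveLeftInverse :
    UniversallyComplementedIn 𝕜 X E ↔
      ∀ (Z : Type u) [NormedAddCommGroup Z] [NormedSpace 𝕜 Z] [CompleteSpace Z],
        FinitelyEquivalent 𝕜 X Z → ∀ i : E →ₗᵢ[𝕜] Z,
          HasContractiveLeftInverse i.toContinuousLinearMap := by
  simp only [UniversallyComplementedIn, exists_isNormOneProjectionOnto_range_iff]

theorem algebraicallyClosedIn_iff_hasContractiveLeftInverse :
    AlgebraicallyClosedIn 𝕜 X E ↔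
      ∀ (Z : Type u) [NormedAddCommGroup Z] [NormedSpace 𝕜 Z] [CompleteSpace Z],
        FinitelyEquivalent 𝕜 X Z → ∀ i : E →ₗᵢ[𝕜] Z,
          HasContractiveLeftInverse (doubleAdjoint i.toContinuousLinearMap) :=
  forall₄_congr fun _ _ _ _ => forall₂_congr fun _ i =>
    exists_isNormOneProjectionOnto_range_iff (doubleAdjointLinearIsometry i)

theorem quasiDual_iff_hasContractiveLeftInverse :
    QuasiDual 𝕜 E ↔ HasContractiveLeftInverse (NormedSpace.inclusionInDoubleDual 𝕜 E) :=
  exists_isNormOneProjectionOnto_range_iff (NormedSpace.inclusionInDoubleDualLi 𝕜)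

theorem UniversallyComplementedIn.algebraicallyClosedIn (h : UniversallyComplementedIn 𝕜 X E) :
    AlgebraicallyClosedIn 𝕜 X E :=
  algebraicallyClosedIn_iff_hasContractiveLeftInverse.2 fun Z _ _ _ hZ i =>
    (universallyComplementedIn_iff_hasContractiveLeftInverse.1 h Z hZ i).doubleAdjoint

theorem AlgebraicallyClosedIn.universallyComplementedIn (h : AlgebraicallyClosedIn 𝕜 X E)
    (hE : QuasiDual 𝕜 E) : UniversallyComplementedIn 𝕜 X E := by
  refine universallyComplementedIn_iff_hasContractiveLeftInverse.2 fun Z _ _ _ hZ i => ?_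
  refine .of_comp ?_ (NormedSpace.inclusionInDoubleDual_norm_le 𝕜 Z)
  rw [← doubleAdjoint_comp_inclusionInDoubleDual]
  exact (algebraicallyClosedIn_iff_hasContractiveLeftInverse.1 h Z hZ i).comp
    (quasiDual_iff_hasContractiveLeftInverse.1 hE)

theorem UniversallyComplementedIn.quasiDual [CompleteSpace X]
    (h : UniversallyComplementedIn 𝕜 X E) (hE : FinitelyRepresentable 𝕜 E X) : QuasiDual 𝕜 E := by
  obtain ⟨I, U, S, hS, hSE⟩ := hE.exists_contraction_bidual_ultrapower
  let i : E →ₗᵢ[𝕜] BanachUltrapower 𝕜 X U :=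
    ⟨(S.comp (NormedSpace.inclusionInDoubleDual 𝕜 E)).toLinearMap, hSE⟩
  have hi : HasContractiveLeftInverse i.toContinuousLinearMap :=
    universallyComplementedIn_iff_hasContractiveLeftInverse.1 h _
      (finitelyEquivalent_ultrapower U) i
  exact quasiDual_iff_hasContractiveLeftInverse.2 (hi.of_comp (j := S) hS)

theorem universallyComplementedIn_iff_extensionPropertyIn [CompleteSpace E] :
    UniversallyComplementedIn 𝕜 X E ↔ ExtensionPropertyIn 𝕜 X E := by
  rw [universallyComplementedIn_iff_hasContractiveLeftInverse]
  refine forall₄_congr fun Z _ _ _ => forall₂_congr fun _ i => ⟨?_, fun h => ?_⟩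
  · rintro ⟨p, hp, hpi⟩ W _ _ _ T
    have hpi' (x : E) : p (i x) = x := DFunLike.congr_fun hpi x
    refine ⟨T.comp p, fun x => congrArg T (hpi' x), le_antisymm ?_ ?_⟩
    · exact (T.opNorm_comp_le p).trans (mul_le_of_le_one_right (norm_nonneg _) hp)
    · refine T.opNorm_le_bound (norm_nonneg _) fun x => ?_
      simpa [hpi'] using (T.comp p).le_opNorm (i x)
  · obtain ⟨p, hpi, hp⟩ := h E (.id 𝕜 E)
    exact ⟨p, hp.trans_le ContinuousLinearMap.norm_id_le, ContinuousLinearMap.ext hpi⟩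

end Complementation

theorem theorem3 {𝕜 : Type} [RCLike 𝕜]
    (X : Type u) [NormedAddCommGroup X] [NormedSpace 𝕜 X] [CompleteSpace X]
    (E : Type u) [NormedAddCommGroup E] [NormedSpace 𝕜 E] [CompleteSpace E] :
    (FinitelyRepresentable 𝕜 E X →
      (UniversallyComplementedIn 𝕜 X E ↔ AlgebraicallyClosedIn 𝕜 X E ∧ QuasiDual 𝕜 E)) ∧
    (UniversallyComplementedIn 𝕜 X E ↔ ExtensionPropertyIn 𝕜 X E) :=
  ⟨fun hE => ⟨fun h => ⟨h.algebraicallyClosedIn, h.quasiDual hE⟩,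
    fun h => h.1.universallyComplementedIn h.2⟩,
    universallyComplementedIn_iff_extensionPropertyIn⟩
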